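/- **Setting.** Let $K$ be a finite simplicial complex and $N\subseteq K$ a closed set of simplices; homology is simplicial with coefficients in a fixed field. A multivector field $\mathcal V$ is a partition of $K$ into sets that are convex for the face relation, and it defines the multivalued dynamics $F_{\mathcal V}(\sigma)=[\sigma]_{\mathcal V}\cup \mathrm{cl}(\sigma)$, where $[\sigma]_{\mathcal V}$ is the member of $\mathcal V$ containing $\sigma$. A solution is a map $\rho:\mathbb Z\to K$ with $\rho(i+1)\in F_{\mathcal V}(\rho(i))$ for all $i$; a path is the same on a finite integer interval. A multivector $V$ is critical if $H_k(\mathrm{cl}(V),\mathrm{cl}(V)\setminus V)\ne0$ for some $k$. A solution $\rho$ is essential if, whenever $[\rho(i)]_{\mathcal V}$ is not critical, $\rho$ lies in a different multivector at some time before $i$ and at some time after $i$. The invariant part $\mathrm{inv}_{\mathcal V}(A)$ is the set of simplices on essential solutions with values in $A$. An isolated invariant set with isolating set $N$ is a set $S\subseteq N$, with $N$ closed, that is a union of multivectors, satisfies $\mathrm{inv}_{\mathcal V}(S)=S$, and contains every path in $N$ with both endpoints in $S$. A Morse decomposition of $S$ is a family $(M_p)$ of mutually disjoint isolated invariant subsets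 of $S$ indexed by a finite poset, such that every essential solution $\rho$ in $S$ either lies in one $M_r$ or satisfies $\bigcap_{i\ge1}\rho((-\infty,-i])\subseteq M_q$ and $\bigcap_{i\ge1}\rho([i,\infty))\subseteq M_p$ for some $p<q$. Let $n$ be given, and for each index $i$ with $0\le i<n$ a multivector field $\mathcal V_i$ on $K$, an isolated invariant set $S_i$ with isolating set $N$, a Morse decomposition $\mathcal M_i$ of $S_i$ (the vertex set of the $i$-th Conley–Morse graph), and for each Morse set in $\mathcal M_i$ a chosen index pair in $N$. Here an index pair in $N$ for $S$ under $\mathcal V$ is a pair of closed sets $E\subseteq P\subseteq N$ with $F_{\mathcal V}(E)\cap N\subseteq E$, $F_{\mathcal V}(P)\cap N\subseteq P$, $F_{\mathcal V}(P\setminus E)\subseteq N$ and $S=\mathrm{inv}_{\mathcal V}(P\setminus E)$, where $S$ is an isolated invariant set with isolating set $N$. A sequence $\{(P_i,E_i)\}_{i=s}^{t}$ of chosen index pairs, with $(P_i,E_i)$ belonging to a Morse set of $\mathcal M_i$, is *feasible* if $(P_i\setminus E_i)\cap(P_{i+1}\setminus E_{i+1})\neq\emptyset$ for $s\le i<t$.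 It is *maximal* if moreover no chosen index pair $(P,E)$ of index $s-1$ satisfies $(P\setminus E)\cap(P_s\setminus E_s)\ne\emptyset$ and none of index $t+1$ satisfies $(P_t\setminus E_t)\cap(P\setminus E)\ne\emptyset$. A *Conley–Morse filtration* is the relative zigzag filtration $$\mathcal F:\ (P_s,E_s)\supseteq(P_s\cap P_{s+1},E_s\cap E_{s+1})\subseteq(P_{s+1},E_{s+1})\supseteq\cdots\subseteq(P_t,E_t)$$ of a maximal sequence. Let $\mathcal Z$ be the set of all Conley–Morse filtrations. For $s\le a\le b\le t$, $\mathcal F_{a,b}$ denotes the part of $\mathcal F$ from $(P_a,E_a)$ to $(P_b,E_b)$. The $k$-dimensional barcode of $\mathcal F$ is the multiset of intervals in the decomposition into interval modules of the zigzag module obtained by applying $H_k$. A bar is viewed as an interval of the real line: $(P_i,E_i)$ occupies the point $i$ and $(P_i\cap P_{i+1},E_i\cap E_{i+1})$ the open interval $(i,i+1)$. We write $\mathcal I_{a,b}$ for a bar whose closure is $[a,b]$. A bar $\mathcal I_{a,b}$ in the $k$-dimensional barcode of $\mathcal F\in\mathcal Z$ is *redundant* if there is $\mathcal G\in\mathcal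 Z$ with $\mathcal G\neq\mathcal F$ and $\mathcal G_{a,b}=\mathcal F_{a,b}$ (in particular, $\mathcal G_{a,b}$ is defined). **Proposition.** Let $\mathcal I_{a,b}$ be a redundant bar in the $k$-dimensional barcode of $\mathcal F\in\mathcal Z$. Then there is $\mathcal G\in\mathcal Z$ with $\mathcal G\ne\mathcal F$ and $\mathcal G_{a,b}=\mathcal F_{a,b}$ whose $k$-dimensional barcode contains a bar $\mathcal I_{c,d}$ with $\mathcal I_{a,b}\subseteq\mathcal I_{c,d}$. In fact, for every $\mathcal G\in\mathcal Z$ with $\mathcal G\neq\mathcal F$ and $\mathcal G_{a,b}=\mathcal F_{a,b}$, the $k$-dimensional barcode of $\mathcal G$ exists and contains such a bar. -/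

import Mathlib

universe u v w

namespace ConleyMorse

section Simplices

variable {V : Type u} (K : PreAbstractSimplicialComplex V)

/-- The simplices of `K`, partially ordered by the face relation. -/
abbrev Simplex : Type u := {σ : Finset V // σ ∈ K.faces}

variable {K}

/-- The closure of a set of simplices: all faces of its members. -/
def cl (A : Set (Simplex K)) : Set (Simplex K) := {τ | ∃ σ ∈ A, τ ≤ σ}

/-- A set of simplices is closed if it contains all faces of its members. -/
def IsClosedSet (A : Set (Simplex K)) : Prop := A = cl A

/-- The mouth of a set of simplices. -/
def mouth (A : Set (Simplex K)) : Set (Simplex K) := cl A \ A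

theorem IsClosedSet.inter {A B : Set (Simplex K)} (hA : IsClosedSet A) (hB : IsClosedSet B) :
    IsClosedSet (A ∩ B) := by
  apply Set.Subset.antisymm
  · exact fun σ hσ => ⟨σ, hσ, le_rfl⟩
  · rintro τ ⟨σ, ⟨h1, h2⟩, hle⟩
    exact ⟨hA ▸ (⟨σ, h1, hle⟩ : τ ∈ cl A), hB ▸ (⟨σ, h2, hle⟩ : τ ∈ cl B)⟩

end Simplices

section Homology

variable (𝕜 : Type v) [Field 𝕜] {V : Type u} {K : PreAbstractSimplicialComplex V}

open Classical in
/-- The boundary of a simplex: the alternating sum of its codimension one faces, where simplices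
are oriented by the order of the vertices. The sign of the face opposite to `v` is `(-1) ^ j`, with
`j` the number of vertices that precede `v`. The boundary of a vertex is zero. -/
noncomputable def simplexBoundary [LinearOrder V] (σ : Simplex K) : Simplex K →₀ 𝕜 :=
  ∑ v ∈ σ.1, if h : (σ.1.erase v).Nonempty then
    Finsupp.single ⟨σ.1.erase v, (K.isRelLowerSet_faces σ.2).2 (Finset.erase_subset v σ.1) h⟩
      ((-1) ^ (σ.1.filter (fun w => w < v)).card)
  else 0

/-- The sum of the chain groups of all degrees: the vector space with basis the simplices. -/
def Chains (K : PreAbstractSimplicialComplex V) : Type (max u v) := Simplex K →₀ 𝕜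

noncomputable instance : AddCommGroup (Chains 𝕜 K) :=
  inferInstanceAs (AddCommGroup (Simplex K →₀ 𝕜))

noncomputable instance : Module 𝕜 (Chains 𝕜 K) :=
  inferInstanceAs (Module 𝕜 (Simplex K →₀ 𝕜))

/-- The simplicial boundary operator. -/
noncomputable def boundary [LinearOrder V] : Chains 𝕜 K →ₗ[𝕜] Chains 𝕜 K :=
  Finsupp.linearCombination 𝕜 (simplexBoundary 𝕜)

/-- The chains with support in `A`, in all degrees. -/
noncomputable def allChains (A : Set (Simplex K)) : Submodule 𝕜 (Chains 𝕜 K) :=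
  Finsupp.supported 𝕜 𝕜 A

/-- The `k`-chains of `A`, spanned by the simplices of `A` with `k + 1` vertices. -/
noncomputable def chains (k : ℕ) (A : Set (Simplex K)) : Submodule 𝕜 (Chains 𝕜 K) :=
  Finsupp.supported 𝕜 𝕜 {σ | σ ∈ A ∧ σ.1.card = k + 1}

theorem chains_mono {P P' : Set (Simplex K)} (k : ℕ) (h : P ⊆ P') :
    chains 𝕜 k P ≤ chains 𝕜 k P' :=
  Finsupp.supported_mono (fun _ hσ => ⟨h hσ.1, hσ.2⟩)

variable [LinearOrder V]

/-- The relative `k`-cycles of `(P, E)`: the `k`-chains of `P` with boundary in `E`. -/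
noncomputable def relCycles (k : ℕ) (P E : Set (Simplex K)) : Submodule 𝕜 (Chains 𝕜 K) :=
  chains 𝕜 k P ⊓ (allChains 𝕜 E).comap (boundary 𝕜)

/-- The relative `k`-boundaries of `(P, E)`: boundaries of `(k+1)`-chains of `P` modulo `k`-chains
of `E`. -/
noncomputable def relBoundaries (k : ℕ) (P E : Set (Simplex K)) :
    Submodule 𝕜 (Chains 𝕜 K) :=
  (chains 𝕜 (k + 1) P).map (boundary 𝕜) ⊔ chains 𝕜 k E

/-- The relative simplicial homology `H_k(P, E)` with coefficients in `𝕜`, for closed `E ⊆ P`. -/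
abbrev RelHomology (k : ℕ) (P E : Set (Simplex K)) : Type (max u v) :=
  relCycles 𝕜 k P E ⧸ (relBoundaries 𝕜 k P E).submoduleOf (relCycles 𝕜 k P E)

variable {P E P' E' : Set (Simplex K)}

theorem relCycles_mono (k : ℕ) (hP : P ⊆ P') (hE : E ⊆ E') :
    relCycles 𝕜 k P E ≤ relCycles 𝕜 k P' E' :=
  inf_le_inf (chains_mono 𝕜 k hP) (Submodule.comap_mono (Finsupp.supported_mono hE))

theorem relBoundaries_mono (k : ℕ) (hP : P ⊆ P') (hE : E ⊆ E') :
    relBoundaries 𝕜 k P E ≤ relBoundaries 𝕜 k P' E' :=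
  sup_le_sup (Submodule.map_mono (chains_mono 𝕜 (k + 1) hP)) (chains_mono 𝕜 k hE)

/-- The map `H_k(P, E) → H_k(P', E')` induced by an inclusion `P ⊆ P'`, `E ⊆ E'`. -/
noncomputable def relHomologyMap (k : ℕ) (hP : P ⊆ P') (hE : E ⊆ E') :
    RelHomology 𝕜 k P E →ₗ[𝕜] RelHomology 𝕜 k P' E' :=
  Submodule.mapQ _ _ (Submodule.inclusion (relCycles_mono 𝕜 k hP hE))
    (fun _ hx => relBoundaries_mono 𝕜 k hP hE hx)

end Homology

section Dynamics

variable {V : Type u} [LinearOrder V]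

/-- A multivector field on `K`: a partition of the simplices of `K`, given as an equivalence
relation, into convex sets. -/
structure MultivectorField (K : PreAbstractSimplicialComplex V) where
  rel : Setoid (Simplex K)
  convex : ∀ σ : Simplex K, Set.OrdConnected {τ | rel.r τ σ}

variable {K : PreAbstractSimplicialComplex V}

namespace MultivectorField

variable (𝒱 : MultivectorField K)

/-- The multivector containing `σ`. -/
def cell (σ : Simplex K) : Set (Simplex K) := {τ | 𝒱.rel.r τ σ}

/-- The multivalued dynamics `F(σ) = [σ] ∪ cl σ`. -/
def F (σ : Simplex K) : Set (Simplex K) := 𝒱.cell σ ∪ cl {σ}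

/-- The image `F(A)` of a set of simplices. -/
def image (A : Set (Simplex K)) : Set (Simplex K) := ⋃ σ ∈ A, 𝒱.F σ

/-- A solution: a bi-infinite sequence of simplices that follows `F`. -/
def IsSolution (ρ : ℤ → Simplex K) : Prop := ∀ i, ρ (i + 1) ∈ 𝒱.F (ρ i)

/-- A path on `ℤ ∩ [a, b]`; the values of `ρ` outside `[a, b]` are irrelevant. -/
def IsPath (ρ : ℤ → Simplex K) (a b : ℤ) : Prop :=
  ∀ i, a ≤ i → i < b → ρ (i + 1) ∈ 𝒱.F (ρ i)

variable (𝕜 : Type v) [Field 𝕜]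

/-- The multivector of `σ` is critical: it has nontrivial relative homology in some degree. -/
def IsCritical (σ : Simplex K) : Prop :=
  ∃ k : ℕ, Nontrivial (RelHomology 𝕜 k (cl (𝒱.cell σ)) (mouth (𝒱.cell σ)))

/-- An essential solution leaves every regular multivector that it visits, both in forward and in
backward time. -/
def IsEssential (ρ : ℤ → Simplex K) : Prop :=
  𝒱.IsSolution ρ ∧ ∀ i, ¬ 𝒱.IsCritical 𝕜 (ρ i) →
    (∃ j, j < i ∧ 𝒱.cell (ρ j) ≠ 𝒱.cell (ρ i)) ∧ (∃ j, i < j ∧ 𝒱.cell (ρ j) ≠ 𝒱.cell (ρ i))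

/-- The invariant part of `A`. -/
def inv (A : Set (Simplex K)) : Set (Simplex K) :=
  {σ | ∃ ρ : ℤ → Simplex K, 𝒱.IsEssential 𝕜 ρ ∧ (∃ i, ρ i = σ) ∧ Set.range ρ ⊆ A}

/-- `S` is an invariant set. -/
def IsInvariant (S : Set (Simplex K)) : Prop := 𝒱.inv 𝕜 S = S

/-- `S` is a union of multivectors. -/
def IsCompatible (S : Set (Simplex K)) : Prop := ∀ σ ∈ S, 𝒱.cell σ ⊆ S

/-- `S` is an isolated invariant set in the (closed) isolating set `N`. -/
structure IsIsolatedIn (N S : Set (Simplex K)) : Prop where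
  closed : IsClosedSet N
  subset : S ⊆ N
  invariant : 𝒱.IsInvariant 𝕜 S
  compatible : 𝒱.IsCompatible S
  isolating : ∀ (ρ : ℤ → Simplex K) (a b : ℤ), a ≤ b → 𝒱.IsPath ρ a b →
    (∀ i ∈ Set.Icc a b, ρ i ∈ N) → ρ a ∈ S → ρ b ∈ S → ∀ i ∈ Set.Icc a b, ρ i ∈ S

end MultivectorField

/-- The `α`-limit set of `ρ`. -/
def alphaLimit (ρ : ℤ → Simplex K) : Set (Simplex K) :=
  ⋂ i : ℕ, ⋂ _ : 1 ≤ i, ρ '' Set.Iic (-(i : ℤ))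

/-- The `ω`-limit set of `ρ`. -/
def omegaLimit (ρ : ℤ → Simplex K) : Set (Simplex K) :=
  ⋂ i : ℕ, ⋂ _ : 1 ≤ i, ρ '' Set.Ici (i : ℤ)

variable (𝕜 : Type v) [Field 𝕜]

/-- The family `M`, indexed by a finite poset, is a Morse decomposition of `S`. -/
structure IsMorseDecomposition (𝒱 : MultivectorField K) (S : Set (Simplex K))
    {I : Type w} [PartialOrder I] (M : I → Set (Simplex K)) : Prop where
  disjoint : ∀ p q, p ≠ q → Disjoint (M p) (M q)
  subset : ∀ p, M p ⊆ S
  isolated : ∀ p, ∃ N, 𝒱.IsIsolatedIn 𝕜 N (M p)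
  gradient : ∀ ρ : ℤ → Simplex K, 𝒱.IsEssential 𝕜 ρ → Set.range ρ ⊆ S →
    (∃ r, Set.range ρ ⊆ M r) ∨
      ∃ p q, p < q ∧ alphaLimit ρ ⊆ M q ∧ omegaLimit ρ ⊆ M p

/-- A pair of closed sets of simplices `E ⊆ P`. -/
@[ext]
structure ClosedPair (K : PreAbstractSimplicialComplex V) where
  P : Set (Simplex K)
  E : Set (Simplex K)
  closed_P : IsClosedSet P
  closed_E : IsClosedSet E
  subset : E ⊆ P

/-- The intersection `(P₁ ∩ P₂, E₁ ∩ E₂)`. -/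
def ClosedPair.inter (A B : ClosedPair K) : ClosedPair K where
  P := A.P ∩ B.P
  E := A.E ∩ B.E
  closed_P := A.closed_P.inter B.closed_P
  closed_E := A.closed_E.inter B.closed_E
  subset := Set.inter_subset_inter A.subset B.subset

/-- `A` is an index pair in `N` for `S` under `𝒱`. -/
structure IsIndexPairIn (𝒱 : MultivectorField K) (N S : Set (Simplex K)) (A : ClosedPair K) :
    Prop where
  isolated : 𝒱.IsIsolatedIn 𝕜 N S
  subset : A.P ⊆ N
  exit_invariant : 𝒱.image A.E ∩ N ⊆ A.E
  invariant : 𝒱.image A.P ∩ N ⊆ A.P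
  exit : 𝒱.image (A.P \ A.E) ⊆ N
  inv_eq : S = 𝒱.inv 𝕜 (A.P \ A.E)

/-- One term of the input sequence: a multivector field, an isolated invariant set in `N`, a Morse
decomposition of it (the vertices of the Conley-Morse graph), and a chosen index pair in `N` for
each Morse set. The edges and annotations of the Conley-Morse graph are determined by these data. -/
structure ConleyMorseDatum (N : Set (Simplex K)) where
  field : MultivectorField K
  S : Set (Simplex K)
  isolated : field.IsIsolatedIn 𝕜 N S
  Index : Type w
  [order : PartialOrder Index]
  [finite : Finite Index]
  morseSet : Index → Set (Simplex K)
  morse : IsMorseDecomposition 𝕜 field S morseSet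
  indexPair : Index → ClosedPair K
  isIndexPair : ∀ p, IsIndexPairIn 𝕜 field N (morseSet p) (indexPair p)

end Dynamics

section Filtrations

variable {V : Type u} [LinearOrder V]

/-- The relative zigzag filtration
`(P_lo, E_lo) ⊇ (P_lo ∩ P_{lo+1}, E_lo ∩ E_{lo+1}) ⊆ (P_{lo+1}, E_{lo+1}) ⊇ ⋯ ⊆ (P_hi, E_hi)`
given by a sequence of closed pairs. -/
structure ZigzagFiltration (K : PreAbstractSimplicialComplex V) where
  lo : ℕ
  hi : ℕ
  le : lo ≤ hi
  pair : Set.Icc lo hi → ClosedPair K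

variable {K : PreAbstractSimplicialComplex V}

namespace ZigzagFiltration

variable (F : ZigzagFiltration K)

/-- The terms of the zigzag filtration. Position `2i` holds `(P_i, E_i)` and position `2i + 1` holds
`(P_i ∩ P_{i+1}, E_i ∩ E_{i+1})`. Both cases are the intersection of the pairs at `⌊t/2⌋` and
`⌈t/2⌉`. -/
def term (t : Set.Icc (2 * F.lo) (2 * F.hi)) : ClosedPair K :=
  (F.pair ⟨t.1 / 2, by have := t.2.1; have := t.2.2; constructor <;> omega⟩).inter
    (F.pair ⟨(t.1 + 1) / 2, by have := t.2.1; have := t.2.2; constructor <;> omega⟩)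

/-- The subfiltration `F_{a,b}`. -/
def sub (a b : ℕ) (ha : F.lo ≤ a) (hab : a ≤ b) (hb : b ≤ F.hi) : ZigzagFiltration K where
  lo := a
  hi := b
  le := hab
  pair := fun i => F.pair ⟨i.1, ha.trans i.2.1, i.2.2.trans hb⟩

end ZigzagFiltration

/-- `(P₁ \ E₁) ∩ (P₂ \ E₂) ≠ ∅`. -/
def Overlap (A B : ClosedPair K) : Prop := ((A.P \ A.E) ∩ (B.P \ B.E)).Nonempty

variable {𝕜 : Type v} [Field 𝕜] {N : Set (Simplex K)} {n : ℕ}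

/-- The index pairs available at index `i`; there are none unless `i < n`. -/
def indexPairsAt (D : Fin n → ConleyMorseDatum.{u, v, w} 𝕜 N) (i : ℕ) : Set (ClosedPair K) :=
  {A | ∃ h : i < n, ∃ p, (D ⟨i, h⟩).indexPair p = A}

/-- The Conley-Morse filtrations (maximal relative zigzag filtrations): those given by the maximal
feasible sequences of the chosen index pairs. -/
structure IsConleyMorseFiltration (D : Fin n → ConleyMorseDatum.{u, v, w} 𝕜 N)
    (F : ZigzagFiltration K) : Prop where
  mem : ∀ i : Set.Icc F.lo F.hi, F.pair i ∈ indexPairsAt D i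
  feasible : ∀ i j : Set.Icc F.lo F.hi, j.1 = i.1 + 1 → Overlap (F.pair i) (F.pair j)
  maximal_left : ∀ i, i + 1 = F.lo → ∀ A ∈ indexPairsAt D i,
    ¬ Overlap A (F.pair ⟨F.lo, le_rfl, F.le⟩)
  maximal_right : ∀ A ∈ indexPairsAt D (F.hi + 1),
    ¬ Overlap (F.pair ⟨F.hi, F.le, le_rfl⟩) A

/-- The set `𝓩` of all Conley-Morse filtrations. -/
def conleyMorseFiltrations (D : Fin n → ConleyMorseDatum.{u, v, w} 𝕜 N) :
    Set (ZigzagFiltration K) :=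
  {F | IsConleyMorseFiltration D F}

end Filtrations

section Barcodes

/-- The arrows of the zigzag: every odd position maps to its two neighbours. -/
def Arrow (s t : ℕ) : Prop := Odd s ∧ (s = t + 1 ∨ t = s + 1)

/-- A zigzag module on the positions `m, …, n`. -/
structure ZigzagModule (𝕜 : Type v) [Field 𝕜] (m n : ℕ) where
  X : Set.Icc m n → Type w
  [addCommGroup : ∀ t, AddCommGroup (X t)]
  [module : ∀ t, Module 𝕜 (X t)]
  map : ∀ s t : Set.Icc m n, Arrow s t → (X s →ₗ[𝕜] X t)

attribute [instance] ZigzagModule.addCommGroup ZigzagModule.module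

/-- Isomorphism of zigzag modules. -/
def ZigzagModule.Isomorphic {𝕜 : Type v} [Field 𝕜] {m n : ℕ}
    (M : ZigzagModule.{v, u} 𝕜 m n) (M' : ZigzagModule.{v, w} 𝕜 m n) : Prop :=
  ∃ e : ∀ t, M.X t ≃ₗ[𝕜] M'.X t,
    ∀ (s t : Set.Icc m n) (h : Arrow s t) (x : M.X s), e t (M.map s t h x) = M'.map s t h (e s x)

/-- A bar: a nonempty run `first, …, last` of consecutive positions. -/
@[ext]
structure Bar where
  first : ℕ
  last : ℕ
  le : first ≤ last

namespace Bar

/-- The part of the real line occupied by a position: position `2i` is the point `i` and position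
`2i + 1` is the open interval `(i, i + 1)`. -/
def cell (t : ℕ) : Set ℝ :=
  if Even t then {((t / 2 : ℕ) : ℝ)} else Set.Ioo ((t / 2 : ℕ) : ℝ) ((t / 2 : ℕ) + 1 : ℝ)

/-- The bar as an interval of the real line. -/
def carrier (I : Bar) : Set ℝ := ⋃ t ∈ Set.Icc I.first I.last, cell t

/-- The index `a` such that the bar is of the form `𝓘_{a,b}`. -/
def left (I : Bar) : ℕ := I.first / 2

/-- The index `b` such that the bar is of the form `𝓘_{a,b}`. -/
def right (I : Bar) : ℕ := (I.last + 1) / 2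

theorem cell_even (i : ℕ) : cell (2 * i) = {(i : ℝ)} := by
  have h : 2 * i / 2 = i := by omega
  simp [cell, h]

theorem cell_odd (i : ℕ) : cell (2 * i + 1) = Set.Ioo (i : ℝ) (i + 1) := by
  have h : (2 * i + 1) / 2 = i := by omega
  have h' : ¬ Even (2 * i + 1) := by simp
  rw [cell, if_neg h', h]

/-- The bar is an interval with closure `[left, right]`. -/
theorem closure_carrier (I : Bar) : closure I.carrier = Set.Icc (I.left : ℝ) I.right := by
  have hle := I.le
  have hsub : I.carrier ⊆ Set.Icc (I.left : ℝ) I.right := by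
    intro x hx
    simp only [carrier, Set.mem_iUnion, Set.mem_Icc, exists_prop] at hx
    obtain ⟨t, ⟨h1, h2⟩, hx⟩ := hx
    obtain ⟨i, rfl | rfl⟩ := Nat.even_or_odd' t
    · rw [cell_even, Set.mem_singleton_iff] at hx
      subst hx
      constructor <;> exact_mod_cast (by simp only [left, right]; omega)
    · rw [cell_odd] at hx
      have h3 : (I.left : ℝ) ≤ i := by exact_mod_cast (by unfold left; omega : I.left ≤ i)
      have h4 : (i : ℝ) + 1 ≤ I.right := by
        exact_mod_cast (by unfold right; omega : i + 1 ≤ I.right)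
      exact ⟨h3.trans hx.1.le, hx.2.le.trans h4⟩
  have hsup : Set.Ioo (I.left : ℝ) I.right ⊆ I.carrier := by
    intro x hx
    have hx0 : 0 ≤ x := le_trans (Nat.cast_nonneg _) hx.1.le
    have hf1 := Nat.floor_le hx0
    have hf2 := Nat.lt_floor_add_one x
    have h1 : I.left ≤ ⌊x⌋₊ := Nat.le_floor hx.1.le
    have h2 : ⌊x⌋₊ < I.right := (Nat.floor_lt hx0).2 hx.2
    simp only [carrier, Set.mem_iUnion, Set.mem_Icc, exists_prop]
    unfold left right at *
    rcases hf1.eq_or_lt with h | h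
    · have h3 : I.first / 2 < ⌊x⌋₊ := by
        have := hx.1
        rw [← h] at this
        exact_mod_cast this
      exact ⟨2 * ⌊x⌋₊, ⟨by omega, by omega⟩, by rw [cell_even]; exact h.symm⟩
    · exact ⟨2 * ⌊x⌋₊ + 1, ⟨by omega, by omega⟩, by rw [cell_odd]; exact ⟨h, hf2⟩⟩
  apply Set.Subset.antisymm
  · exact closure_minimal hsub isClosed_Icc
  · rcases (show I.left ≤ I.right by unfold left right; omega).eq_or_lt with h | h
    · have h1 : (I.left : ℝ) ∈ I.carrier := by
        simp only [carrier, Set.mem_iUnion, Set.mem_Icc, exists_prop]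
        exact ⟨2 * I.left, by unfold left right at *; omega, by rw [cell_even]; rfl⟩
      rw [← h, Set.Icc_self]
      exact (Set.singleton_subset_iff.2 h1).trans subset_closure
    · rw [← closure_Ioo (by exact_mod_cast h.ne)]
      exact closure_mono hsup
end Bar

variable (𝕜 : Type v) [Field 𝕜]

open Classical in
/-- The direct sum of the interval modules of the bars in `B`: at position `t` it has one copy of
`𝕜` for each bar that contains `t` (with multiplicity), and an arrow is the identity on each bar
that contains both of its ends and zero on the other bars. -/
noncomputable def intervalSum (m n : ℕ) (B : Multiset Bar) : ZigzagModule.{v, v} 𝕜 m n where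
  X t := {x : B.ToType // t.1 ∈ Set.Icc x.1.first x.1.last} → 𝕜
  map s t _ :=
    { toFun := fun f x =>
        if h : s.1 ∈ Set.Icc x.1.1.first x.1.1.last then f ⟨x.1, h⟩ else 0
      map_add' := by
        intro f g
        funext x
        by_cases h : s.1 ∈ Set.Icc x.1.1.first x.1.1.last <;> simp only [h, dif_pos, dif_neg,
          not_false_eq_true, Pi.add_apply, add_zero]
      map_smul' := by
        intro c f
        funext x
        by_cases h : s.1 ∈ Set.Icc x.1.1.first x.1.1.last <;> simp only [h, dif_pos, dif_neg,
          not_false_eq_true, Pi.smul_apply, smul_zero, RingHom.id_apply] }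

variable {𝕜}

/-- `B` is the barcode of `M`: the multiset of bars in a decomposition of `M` into interval
modules. -/
def IsBarcode {m n : ℕ} (M : ZigzagModule.{v, w} 𝕜 m n) (B : Multiset Bar) : Prop :=
  (∀ I ∈ B, m ≤ I.first ∧ I.last ≤ n) ∧ M.Isomorphic (intervalSum 𝕜 m n B)

variable (𝕜) {V : Type u} {K : PreAbstractSimplicialComplex V}

theorem ZigzagFiltration.term_mono (F : ZigzagFiltration K)
    (s t : Set.Icc (2 * F.lo) (2 * F.hi)) (h : Arrow s t) :
    (F.term s).P ⊆ (F.term t).P ∧ (F.term s).E ⊆ (F.term t).E := by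
  obtain ⟨s, hs⟩ := s
  obtain ⟨t, ht⟩ := t
  obtain ⟨⟨i, hi⟩, h⟩ := h
  simp only at hi h
  have key : ∀ (j : ℕ) (hj : j ∈ Set.Icc F.lo F.hi), j = s / 2 ∨ j = (s + 1) / 2 →
      (F.term ⟨s, hs⟩).P ⊆ (F.pair ⟨j, hj⟩).P ∧ (F.term ⟨s, hs⟩).E ⊆ (F.pair ⟨j, hj⟩).E := by
    rintro j hj (rfl | rfl)
    · exact ⟨Set.inter_subset_left, Set.inter_subset_left⟩
    · exact ⟨Set.inter_subset_right, Set.inter_subset_right⟩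
  have hlo := ht.1
  have hhi := ht.2
  have h1 := key (t / 2) (by constructor <;> omega) (by omega)
  have h2 := key ((t + 1) / 2) (by constructor <;> omega) (by omega)
  exact ⟨Set.subset_inter h1.1 h2.1, Set.subset_inter h1.2 h2.2⟩

variable [LinearOrder V]

/-- The zigzag module `H_k(P_lo, E_lo) ← H_k(P_lo ∩ P_{lo+1}, E_lo ∩ E_{lo+1}) → ⋯ → H_k(P_hi, E_hi)`
of a relative zigzag filtration, with the maps induced by inclusion. -/
noncomputable def ZigzagFiltration.homology (F : ZigzagFiltration K) (k : ℕ) :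
    ZigzagModule.{v, max u v} 𝕜 (2 * F.lo) (2 * F.hi) where
  X t := RelHomology 𝕜 k (F.term t).P (F.term t).E
  map s t h := relHomologyMap 𝕜 k (F.term_mono s t h).1 (F.term_mono s t h).2

/-- `B` is the `k`-dimensional barcode of the filtration `F`. -/
def IsBarcodeOf (k : ℕ) (F : ZigzagFiltration K) (B : Multiset Bar) : Prop :=
  IsBarcode (F.homology 𝕜 k) B

/-- `F_{a,b}` and `G_{a,b}` are both defined and equal. -/
def SameSubfiltration (F G : ZigzagFiltration K) (a b : ℕ) : Prop :=
  ∃ (hab : a ≤ b) (hF₁ : F.lo ≤ a) (hF₂ : b ≤ F.hi) (hG₁ : G.lo ≤ a) (hG₂ : b ≤ G.hi),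
    G.sub a b hG₁ hab hG₂ = F.sub a b hF₁ hab hF₂

variable {𝕜} {N : Set (Simplex K)} {n : ℕ}

/-- `G` is another Conley-Morse filtration that makes the bar `I` of `F` redundant. -/
def IsRedundancyWitness (D : Fin n → ConleyMorseDatum.{u, v, w} 𝕜 N) (F : ZigzagFiltration K)
    (I : Bar) (G : ZigzagFiltration K) : Prop :=
  G ∈ conleyMorseFiltrations D ∧ G ≠ F ∧ SameSubfiltration F G I.left I.right

/-- The bar `I` of `F` is redundant. -/
def IsRedundant (D : Fin n → ConleyMorseDatum.{u, v, w} 𝕜 N) (F : ZigzagFiltration K)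
    (I : Bar) : Prop :=
  ∃ G, IsRedundancyWitness D F I G

end Barcodes

end ConleyMorse

/-! Two facts about zigzag modules over a field carry the proof. The first is existence: a pointwise
finite-dimensional zigzag module is a sum of interval modules (`ZigzagModule.exists_isBarcode`).
Since `K` is finite, every filtration then has a barcode. The decomposition is built from left to
right: a basis adapted to bars is kept up to some position, changed by a triangular matrix so that
it fits the next arrow, and extended by one position.

The second is comparison (`exists_bar_of_isomorphic_restrict`): if two decomposed modules are
isomorphic over the positions of a bar `x` of the first, some bar of the second contains `x`. For
each bar `y` of the second, composing `x → y → x` through the isomorphism and its inverse gives a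
scalar at each position. This scalar is constant along `x`, vanishes wherever `y` is absent, and
sums to `1` over all `y`. A bar `y` with nonzero scalar therefore covers `x`. No uniqueness of
barcodes is needed.

For a redundant bar `I`, the filtrations `F` and `G` have equal terms at all positions of `I`, so
their homology modules agree there and the comparison applies. -/

namespace ConleyMorse

/-! ### Column reduction and bases of kernels. -/

section LinearAlgebra

open Submodule

variable {𝕜 : Type v} [Field 𝕜] {V : Type u} [AddCommGroup V] [Module 𝕜 V]
  {W : Type w} [AddCommGroup W] [Module 𝕜 W]

/-- A family indexed by a linear order is linearly independent if no member lies in the span of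
its predecessors. -/
theorem linearIndependent_of_notMem_span_Iio {ι : Type*} [LinearOrder ι] {v : ι → V}
    (h : ∀ i, v i ∉ span 𝕜 (v '' Set.Iio i)) : LinearIndependent 𝕜 v := by
  rw [linearIndependent_iff]
  intro l hl
  by_contra hne
  have hs : l.support.Nonempty := Finsupp.support_nonempty_iff.2 hne
  set i := l.support.max' hs with hi
  have him : i ∈ l.support := Finset.max'_mem _ _
  have h0 : l i ≠ 0 := Finsupp.mem_support_iff.1 him
  apply h i
  rw [Finsupp.linearCombination_apply, Finsupp.sum, ← Finset.add_sum_erase _ _ him] at hl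
  have h1 : v i = -(l i)⁻¹ • ∑ j ∈ l.support.erase i, l j • v j := by
    rw [eq_neg_of_add_eq_zero_right hl, smul_neg, neg_smul, neg_neg, smul_smul,
      inv_mul_cancel₀ h0, one_smul]
  rw [h1]
  refine smul_mem _ _ (sum_mem fun j hj => smul_mem _ _ (subset_span ⟨j, ?_, rfl⟩))
  exact lt_of_le_of_ne (Finset.le_max' _ _ (Finset.mem_of_mem_erase hj)) (Finset.ne_of_mem_erase hj)

/-- Column reduction: a family can be changed by a unitriangular matrix so that a linear map kills
some of its members and is independent on the others. -/
theorem exists_unitriangular_reduction {ι : Type*} [LinearOrder ι] [Fintype ι] (A : Set ι)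
    (f : V →ₗ[𝕜] W) (v : ι → V) :
    ∃ (c : ι → ι → 𝕜) (Z : Set ι), Z ⊆ A ∧ (∀ i j, c i j ≠ 0 → i ∈ A ∧ j ∈ A ∧ j < i) ∧
      (∀ i ∈ Z, f (v i + ∑ j, c i j • v j) = 0) ∧
      LinearIndependent 𝕜 (fun i : (A \ Z : Set ι) => f (v i + ∑ j, c i j • v j)) := by
  classical
  -- `Z` collects the dependent columns: a relation with smaller columns gives the row of `c` that
  -- kills such a column. The other rows are zero.
  let Z : Set ι := {i | i ∈ A ∧ f (v i) ∈ span 𝕜 ((fun j => f (v j)) '' {j | j ∈ A ∧ j < i})}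
  have key : ∀ i ∈ Z, ∃ c : ι → 𝕜, (∀ j, c j ≠ 0 → j ∈ A ∧ j < i) ∧
      f (v i + ∑ j, c j • v j) = 0 := by
    rintro i ⟨-, hi⟩
    obtain ⟨l, hl, hlf⟩ := (Finsupp.mem_span_image_iff_linearCombination 𝕜).1 hi
    refine ⟨fun j => -l j, fun j hj => ?_, ?_⟩
    · exact (Finsupp.mem_supported 𝕜 l).1 hl (Finsupp.mem_support_iff.2 (neg_ne_zero.1 hj))
    · rw [map_add, map_sum, ← hlf, Finsupp.linearCombination_apply,
        Finsupp.sum_fintype _ _ (by simp)]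
      simp
  choose! c hc using key
  refine ⟨fun i => if i ∈ Z then c i else 0, Z, fun i hi => hi.1, ?_, ?_, ?_⟩
  · intro i j h
    by_cases hi : i ∈ Z
    · simp only [hi, if_true] at h
      exact ⟨hi.1, (hc i hi).1 j h⟩
    · simp [hi] at h
  · intro i hi
    simp only [hi, if_true]
    exact (hc i hi).2
  · have heq : (fun i : (A \ Z : Set ι) =>
        f (v i + ∑ j, (if i.1 ∈ Z then c i else 0 : ι → 𝕜) j • v j)) =
        fun i : (A \ Z : Set ι) => f (v i) := by
      funext i
      simp [i.2.2]
    rw [heq]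
    apply linearIndependent_of_notMem_span_Iio
    intro i hi
    refine i.2.2 ⟨i.2.1, span_mono ?_ hi⟩
    rintro _ ⟨j, hj, rfl⟩
    exact ⟨j, ⟨j.2.1, hj⟩, rfl⟩

/-- If `v` spans, its members outside of `A` vanish and `A` has as many elements as the dimension,
then the members killed by `f` are a basis of the kernel provided that `f` is independent on the
other ones. -/
theorem span_eq_ker_and_card_eq {ι : Type*} [Finite ι] [FiniteDimensional 𝕜 V]
    {A Z : Set ι} {f : V →ₗ[𝕜] W} {v : ι → V} (hspan : span 𝕜 (Set.range v) = ⊤)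
    (hA : ∀ i, i ∉ A → v i = 0) (hcard : Nat.card A = Module.finrank 𝕜 V) (hZA : Z ⊆ A)
    (hZ : ∀ i ∈ Z, f (v i) = 0)
    (hind : LinearIndependent 𝕜 (fun i : (A \ Z : Set ι) => f (v i))) :
    span 𝕜 (v '' Z) = LinearMap.ker f ∧
      Nat.card Z = Module.finrank 𝕜 (LinearMap.ker f) := by
  classical
  have := Fintype.ofFinite ι
  constructor
  · apply le_antisymm
    · rw [span_le]
      rintro _ ⟨i, hi, rfl⟩
      exact hZ i hi
    · intro x hx
      have hx' : x ∈ span 𝕜 (Set.range v) := hspan ▸ mem_top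
      obtain ⟨a, rfl⟩ := (mem_span_range_iff_exists_fun 𝕜).1 hx'
      have h0 : ∑ i : (A \ Z : Set ι), a i • f (v i) = 0 := by
        rw [LinearMap.mem_ker, map_sum] at hx
        rw [← hx, ← Finset.sum_subtype (Finset.univ.filter (· ∈ A \ Z)) (by simp)
          (fun i => a i • f (v i)), Finset.sum_filter]
        refine Finset.sum_congr rfl fun i _ => ?_
        rw [map_smul]
        split_ifs with h
        · rfl
        · by_cases hi : i ∈ A
          · rw [hZ i (by by_contra h'; exact h ⟨hi, h'⟩), smul_zero]
          · rw [hA i hi, map_zero, smul_zero]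
      have h1 := Fintype.linearIndependent_iff.1 hind (fun i => a i) h0
      refine sum_mem fun i _ => ?_
      by_cases hi : i ∈ Z
      · exact smul_mem _ _ (subset_span ⟨i, hi, rfl⟩)
      · by_cases hiA : i ∈ A
        · have := h1 ⟨i, hiA, hi⟩
          simp only at this
          simp [this]
        · simp [hA i hiA]
  -- The members in `A \ Z` give a basis of the range, so rank-nullity counts `Z`.
  · have hr : LinearMap.range f = span 𝕜 (Set.range fun i : (A \ Z : Set ι) => f (v i)) := by
      apply le_antisymm
      · rw [LinearMap.range_eq_map, ← hspan, map_span_le]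
        rintro _ ⟨i, rfl⟩
        by_cases hi : i ∈ A \ Z
        · exact subset_span ⟨⟨i, hi⟩, rfl⟩
        · by_cases hiA : i ∈ A
          · rw [hZ i (by by_contra h'; exact hi ⟨hiA, h'⟩)]
            exact zero_mem _
          · rw [hA i hiA, map_zero]
            exact zero_mem _
      · rw [span_le]
        rintro _ ⟨i, rfl⟩
        exact ⟨_, rfl⟩
    have h1 := LinearMap.finrank_range_add_finrank_ker f
    rw [hr, finrank_span_eq_card hind, ← hcard, ← Nat.card_eq_fintype_card] at h1
    have h2 := Set.ncard_sdiff_add_ncard_of_subset hZA (Set.toFinite A)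
    simp only [← Nat.card_coe_set_eq] at h2
    omega

end LinearAlgebra

/-! ### Interval decomposition of finite-dimensional zigzag modules. -/

section Decomposition

open Submodule

variable {𝕜 : Type v} [Field 𝕜] {m n : ℕ}

/-- Vectors `e i t` that form a basis of `M` at each position `t ≤ r`, when those `i` are taken
whose bar contains `t`, and that are transported by the arrows along the bars. -/
structure IsIntervalBasis (M : ZigzagModule.{v, w} 𝕜 m n) (r : ℕ) {ι : Type} [Fintype ι]
    (bar : ι → Bar) (e : ι → ∀ t, M.X t) : Prop where
  le_first : ∀ i, m ≤ (bar i).first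
  last_le : ∀ i, (bar i).last ≤ r
  eq_zero : ∀ i t, t.1 ∉ Set.Icc (bar i).first (bar i).last → e i t = 0
  map_eq : ∀ s t (h : Arrow s.1 t.1), s.1 ≤ r → t.1 ≤ r →
    ∀ i, s.1 ∈ Set.Icc (bar i).first (bar i).last → M.map s t h (e i s) = e i t
  span_eq : ∀ t, t.1 ≤ r → span 𝕜 (Set.range fun i => e i t) = ⊤
  card_eq : ∀ t, t.1 ≤ r →
    Nat.card {i | t.1 ∈ Set.Icc (bar i).first (bar i).last} = Module.finrank 𝕜 (M.X t)

/-- The bars with a common right end are ordered by this function of their left ends: there is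
a nonzero map from a bar to each smaller one. -/
def birthKey (b : ℕ) : ℤ := if Odd b then -b else b

-- All bars involved end at `r`, so only left ends can obstruct compatibility with the arrows. At an
-- odd left end an arrow leaves the bar and must kill the vector; at an even left end an arrow
-- enters the bar from outside. The inequality of keys is what both cases require. Well-foundedness
-- of `lt` makes the change of vectors invertible, whence the span is preserved.
open Classical in
theorem IsIntervalBasis.triangular {M : ZigzagModule.{v, w} 𝕜 m n} {r : ℕ} {ι : Type} [Fintype ι]
    {bar : ι → Bar} {e : ι → ∀ t, M.X t} (h : IsIntervalBasis M r bar e) (lt : ι → ι → Prop)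
    (wf : WellFounded lt) (c : ι → ι → 𝕜)
    (hc : ∀ i j, c i j ≠ 0 → (bar i).last = r ∧ (bar j).last = r ∧ lt j i ∧
      birthKey (bar j).first ≤ birthKey (bar i).first) :
    IsIntervalBasis M r bar (fun i t => if t.1 ∈ Set.Icc (bar i).first (bar i).last then
      e i t + ∑ j, c i j • e j t else 0) where
  le_first := h.le_first
  last_le := h.last_le
  eq_zero i t ht := if_neg ht
  card_eq := h.card_eq
  span_eq t ht := by
    rw [eq_top_iff, ← h.span_eq t ht, span_le]
    rintro _ ⟨i, rfl⟩
    induction i using wf.induction with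
    | _ i ih =>
      by_cases hi : t.1 ∈ Set.Icc (bar i).first (bar i).last
      · have h1 : e i t = (e i t + ∑ j, c i j • e j t) - ∑ j, c i j • e j t := by abel
        show e i t ∈ span _ _
        rw [h1]
        refine sub_mem (subset_span ⟨i, if_pos hi⟩) (sum_mem fun j _ => ?_)
        by_cases hj : c i j = 0
        · rw [hj, zero_smul]
          exact zero_mem _
        · exact smul_mem _ _ (ih j (hc i j hj).2.2.1)
      · show e i t ∈ span _ _
        rw [h.eq_zero i t hi]
        exact zero_mem _
  map_eq s t a hs ht i hi := by
    have hmap : ∀ j, ¬ s.1 ∈ Set.Icc (bar j).first (bar j).last → M.map s t a (e j s) = 0 := by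
      intro j hj
      rw [h.eq_zero j s hj, map_zero]
    rw [if_pos hi, map_add, map_sum, h.map_eq s t a hs ht i hi]
    have hst := a.2
    obtain ⟨d, hd⟩ := a.1
    simp only [Set.mem_Icc] at hi hmap
    split_ifs with hit
    · congr 1
      refine Finset.sum_congr rfl fun j _ => ?_
      rw [map_smul]
      by_cases hj : c i j = 0
      · simp [hj]
      obtain ⟨h1, h2, -, h3⟩ := hc i j hj
      congr 1
      by_cases hjs : s.1 ∈ Set.Icc (bar j).first (bar j).last
      · exact h.map_eq s t a hs ht j hjs
      · rw [h.eq_zero j s hjs, map_zero, h.eq_zero j t]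
        intro hjt
        simp only [Set.mem_Icc] at hjs hjt hit
        -- Here the even position `t` is the left end of bar `j`, while bar `i` starts earlier. The
        -- keys forbid this.
        have h4 : ¬ Odd (bar j).first := by
          rw [Nat.not_odd_iff]
          omega
        rw [birthKey, if_neg h4, birthKey] at h3
        split_ifs at h3 <;> omega
    · rw [h.eq_zero i t hit, zero_add]
      refine Finset.sum_eq_zero fun j _ => ?_
      rw [map_smul]
      by_cases hj : c i j = 0
      · simp [hj]
      obtain ⟨h1, h2, -, h3⟩ := hc i j hj
      by_cases hjs : s.1 ∈ Set.Icc (bar j).first (bar j).last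
      · rw [h.map_eq s t a hs ht j hjs, h.eq_zero j t, smul_zero]
        intro hjt
        simp only [Set.mem_Icc] at hjs hjt hit
        -- Here the odd position `s` is the left end of bar `i` and `t = s - 1` lies in bar `j`, so
        -- bar `j` starts earlier. The keys forbid this too.
        have h4 : Odd (bar i).first := by
          rw [Nat.odd_iff]
          omega
        rw [birthKey, birthKey, if_pos h4] at h3
        split_ifs at h3 <;> omega
      · rw [h.eq_zero j s hjs, map_zero, smul_zero]

/-- An interval basis up to the position `t` can be adapted to the kernel of a linear map on the
space at `t`. -/
theorem IsIntervalBasis.exists_adapted {M : ZigzagModule.{v, w} 𝕜 m n} {ι : Type} [Fintype ι]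
    {bar : ι → Bar} {t : Set.Icc m n} {e : ι → ∀ t, M.X t} (h : IsIntervalBasis M t.1 bar e)
    {W : Type w} [AddCommGroup W] [Module 𝕜 W] (f : M.X t →ₗ[𝕜] W) :
    ∃ (e' : ι → ∀ t, M.X t) (Z : Set ι), IsIntervalBasis M t.1 bar e' ∧
      Z ⊆ {i | (bar i).last = t.1} ∧ (∀ i ∈ Z, f (e' i t) = 0) ∧
      LinearIndependent 𝕜 (fun i : ({i | (bar i).last = t.1} \ Z : Set ι) => f (e' i t)) := by
  classical
  -- Column reduction needs a linear order. Ties between bars with equal key are broken by an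
  -- arbitrary enumeration.
  let φ : ι → ℤ ×ₗ Fin (Fintype.card ι) := fun i =>
    toLex (birthKey (bar i).first, Fintype.equivFin ι i)
  have hφ : Function.Injective φ := fun i j hij =>
    (Fintype.equivFin ι).injective (congrArg (fun x => (ofLex x).2) hij)
  let _ : LinearOrder ι := LinearOrder.lift' φ hφ
  obtain ⟨c, Z, hZ, hc, hZf, hind⟩ := exists_unitriangular_reduction
    {i | (bar i).last = t.1} f (fun i => e i t)
  have hal : ∀ i, (bar i).last = t.1 → t.1 ∈ Set.Icc (bar i).first (bar i).last :=
    fun i hi => ⟨hi ▸ (bar i).le, hi.ge⟩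
  refine ⟨_, Z, h.triangular (· < ·) wellFounded_lt c fun i j hij => ?_, hZ, ?_, ?_⟩
  · obtain ⟨h1, h2, h3⟩ := hc i j hij
    refine ⟨h1, h2, h3, ?_⟩
    have h4 : φ j < φ i := h3
    rcases (Prod.Lex.toLex_lt_toLex.1 h4) with h5 | h5
    · exact h5.le
    · exact h5.1.le
  · intro i hi
    simp only [hal i (hZ hi), if_true]
    exact hZf i hi
  · convert hind using 2 with i
    rw [if_pos (hal i i.2.1)]

/-- Extension of an interval basis by one position: the bars in `L` continue, those not in `L` end,
and the vectors `u` start new bars. -/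
theorem IsIntervalBasis.extend {M : ZigzagModule.{v, w} 𝕜 m n} {ι : Type} [Fintype ι]
    {bar : ι → Bar} {t₀ t₁ : Set.Icc m n} (ht : t₁.1 = t₀.1 + 1) {e : ι → ∀ t, M.X t}
    (h : IsIntervalBasis M t₀.1 bar e) (L : Set ι) (hL : ∀ i ∈ L, (bar i).last = t₀.1)
    (p : ι → M.X t₁) (hp : ∀ i, i ∉ L → p i = 0) {κ : Type} [Fintype κ] (u : κ → M.X t₁)
    (hspan : span 𝕜 (Set.range p ∪ Set.range u) = ⊤)
    (hcard : Nat.card L + Nat.card κ = Module.finrank 𝕜 (M.X t₁))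
    (hf : ∀ a : Arrow t₀.1 t₁.1, ∀ i, (bar i).last = t₀.1 → M.map t₀ t₁ a (e i t₀) = p i)
    (hg : ∀ a : Arrow t₁.1 t₀.1, (∀ i ∈ L, M.map t₁ t₀ a (p i) = e i t₀) ∧
      ∀ j, M.map t₁ t₀ a (u j) = 0) :
    ∃ (ι' : Type) (_ : Fintype ι') (bar' : ι' → Bar) (e' : ι' → ∀ t, M.X t),
      IsIntervalBasis M t₁.1 bar' e' := by
  classical
  let bar' : ι ⊕ κ → Bar := Sum.elim
    (fun i => if hi : i ∈ L then ⟨(bar i).first, t₁.1, by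
      have := (bar i).le; have := hL i hi; omega⟩ else bar i)
    (fun _ => ⟨t₁.1, t₁.1, le_rfl⟩)
  let e' : ι ⊕ κ → ∀ t, M.X t := Sum.elim
    (fun i => Function.update (e i) t₁ (p i)) (fun j => Function.update 0 t₁ (u j))
  have hne : ∀ t : Set.Icc m n, t.1 ≤ t₀.1 → t ≠ t₁ := by
    rintro t h1 rfl
    omega
  have hll : ∀ i, (bar i).last ≤ t₀.1 := h.last_le
  have hal : ∀ i t, t ≤ t₀.1 → (t ∈ Set.Icc (bar' (.inl i)).first (bar' (.inl i)).last ↔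
      t ∈ Set.Icc (bar i).first (bar i).last) := by
    intro i t h1
    by_cases hi : i ∈ L
    · have := hL i hi
      simp only [bar', Sum.elim_inl, hi, dif_pos, Set.mem_Icc]
      omega
    · simp [bar', hi]
  have hal₁ : ∀ i, t₁.1 ∈ Set.Icc (bar' (.inl i)).first (bar' (.inl i)).last ↔ i ∈ L := by
    intro i
    by_cases hi : i ∈ L
    · have := hL i hi
      have := (bar i).le
      simp only [bar', Sum.elim_inl, hi, dif_pos, Set.mem_Icc, iff_true]
      omega
    · have := hll i
      simp only [bar', Sum.elim_inl, hi, dif_neg, not_false_eq_true, Set.mem_Icc, iff_false]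
      omega
  have hel : ∀ i t, t ≠ t₁ → e' (.inl i) t = e i t := fun i t h1 =>
    Function.update_of_ne h1 _ _
  have her : ∀ j t, t ≠ t₁ → e' (.inr j) t = 0 := fun i t h1 =>
    Function.update_of_ne h1 _ _
  have hel₁ : ∀ i, e' (.inl i) t₁ = p i := fun i => Function.update_self _ _ _
  have her₁ : ∀ j, e' (.inr j) t₁ = u j := fun i => Function.update_self _ _ _
  have hlt : ∀ t : Set.Icc m n, t.1 ≤ t₁.1 → t ≠ t₁ → t.1 ≤ t₀.1 := by
    intro t h1 h2
    have : t.1 ≠ t₁.1 := fun h3 => h2 (Subtype.ext h3)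
    omega
  refine ⟨ι ⊕ κ, inferInstance, bar', e', ⟨?_, ?_, ?_, ?_, ?_, ?_⟩⟩
  · rintro (i | j)
    · have := h.le_first i
      by_cases hi : i ∈ L <;> simpa [bar', hi] using this
    · exact t₁.2.1
  · rintro (i | j)
    · have := hll i
      by_cases hi : i ∈ L
      · simp [bar', hi]
      · simp only [bar', Sum.elim_inl, hi, dif_neg, not_false_eq_true]
        omega
    · exact le_rfl
  · rintro (i | j) t hi
    · by_cases h1 : t = t₁
      · subst h1
        rw [hal₁] at hi
        rw [hel₁, hp i hi]
      · rw [hel i t h1]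
        apply h.eq_zero
        by_cases h2 : t.1 ≤ t₀.1
        · rwa [hal i t h2] at hi
        · intro h3
          exact h2 (h3.2.trans (hll i))
    · apply her
      rintro rfl
      exact hi ⟨le_rfl, le_rfl⟩
  · intro s t a hs ht' i hi
    have ha := a.2
    by_cases h1 : s = t₁
    · subst h1
      obtain rfl : t = t₀ := Subtype.ext (by omega)
      obtain i | j := i
      · rw [hal₁] at hi
        rw [hel₁, hel i t (hne t le_rfl), (hg a).1 i hi]
      · rw [her₁, her j t (hne t le_rfl), (hg a).2 j]
    · have h1' := hlt s hs h1
      obtain i | j := i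
      · rw [hal i s h1'] at hi
        rw [hel i s h1]
        by_cases h2 : t = t₁
        · subst h2
          obtain rfl : s = t₀ := Subtype.ext (by omega)
          rw [hel₁]
          exact hf a i (le_antisymm (hll i) hi.2)
        · rw [hel i t h2]
          exact h.map_eq s t a h1' (hlt t ht' h2) i hi
      · exact absurd hi.1 (by simp only [bar', Sum.elim_inr]; omega)
  · intro t ht'
    by_cases h2 : t = t₁
    · subst h2
      rw [← hspan, ← Set.Sum.elim_range]
      congr 2
      funext i
      obtain i | j := i
      · exact hel₁ i
      · exact her₁ j
    · rw [eq_top_iff, ← h.span_eq t (hlt t ht' h2)]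
      apply span_mono
      rintro _ ⟨i, rfl⟩
      exact ⟨.inl i, hel i t h2⟩
  · intro t ht'
    have hsum : Nat.card {i | t.1 ∈ Set.Icc (bar' i).first (bar' i).last} =
        Nat.card {i | t.1 ∈ Set.Icc (bar' (.inl i)).first (bar' (.inl i)).last} +
        Nat.card {j : κ | t.1 ∈ Set.Icc (bar' (.inr j)).first (bar' (.inr j)).last} := by
      rw [← Nat.card_sum]
      exact Nat.card_congr (Equiv.subtypeSum)
    rw [hsum]
    by_cases h2 : t = t₁
    · subst h2
      rw [← hcard]
      congr 1
      · exact Nat.card_congr (Equiv.setCongr (Set.ext fun i => hal₁ i))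
      · simp [bar']
    · have h3 := hlt t ht' h2
      rw [← h.card_eq t h3]
      have h4 : {j : κ | t.1 ∈ Set.Icc (bar' (.inr j)).first (bar' (.inr j)).last} = ∅ := by
        ext j
        simp only [bar', Sum.elim_inr, Set.mem_ofPred_eq, Set.mem_Icc, Set.mem_empty_iff_false,
          iff_false]
        omega
      rw [h4, Nat.card_of_isEmpty (α := (∅ : Set κ)), add_zero]
      exact Nat.card_congr (Equiv.setCongr (Set.ext fun i => hal i t h3))

/-- The parity of `t₀` decides the direction of the new arrow. For an arrow `g` into `t₀`, the bars
whose vectors form a basis of the range of `g` continue by lifting, the others end, and a basis of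
the kernel of `g` starts new bars. For an arrow `f` out of `t₀`, the bars killed by `f` end, the
others continue, and a basis of a complement of their images starts new bars. -/
theorem IsIntervalBasis.exists_succ {M : ZigzagModule.{v, w} 𝕜 m n}
    [∀ t, FiniteDimensional 𝕜 (M.X t)] {ι : Type} [Fintype ι]
    {bar : ι → Bar} {t₀ t₁ : Set.Icc m n} (ht : t₁.1 = t₀.1 + 1) {e : ι → ∀ t, M.X t}
    (h : IsIntervalBasis M t₀.1 bar e) :
    ∃ (ι' : Type) (_ : Fintype ι') (bar' : ι' → Bar) (e' : ι' → ∀ t, M.X t),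
      IsIntervalBasis M t₁.1 bar' e' := by
  classical
  have hal : ∀ i, (bar i).last = t₀.1 ↔ t₀.1 ∈ Set.Icc (bar i).first (bar i).last := by
    intro i
    have := h.last_le i
    have := (bar i).le
    simp only [Set.mem_Icc]
    omega
  have hcardA : Nat.card {i | (bar i).last = t₀.1} = Module.finrank 𝕜 (M.X t₀) := by
    rw [← h.card_eq t₀ le_rfl]
    exact Nat.card_congr (Equiv.setCongr (Set.ext hal))
  rcases Nat.even_or_odd t₀.1 with hev | hodd
  · have a : Arrow t₁.1 t₀.1 := ⟨ht ▸ hev.add_one, Or.inl ht⟩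
    have na : ¬ Arrow t₀.1 t₁.1 := fun a => (Nat.not_odd_iff_even.2 hev) a.1
    set g := M.map t₁ t₀ a
    -- The kernel of the quotient map is the range of `g`, so `Z` indexes a basis of that range.
    obtain ⟨e, Z, h, hZA, hZ, hind⟩ := h.exists_adapted (LinearMap.range g).mkQ
    obtain ⟨hs, hc⟩ := span_eq_ker_and_card_eq (h.span_eq t₀ le_rfl)
      (fun i hi => h.eq_zero i t₀ (mt (hal i).2 hi)) hcardA hZA hZ hind
    rw [ker_mkQ] at hs hc
    have hpre : ∀ i ∈ Z, ∃ y, g y = e i t₀ := fun i hi => by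
      have := hs.le (subset_span ⟨i, hi, rfl⟩)
      exact this
    choose! p hp using hpre
    let b := Module.finBasis 𝕜 (LinearMap.ker g)
    refine h.extend ht Z hZA (fun i => if i ∈ Z then p i else 0) (fun i hi => if_neg hi)
      (fun j => (b j : M.X t₁)) ?_ ?_ (fun a => absurd a na) (fun _ => ⟨fun i hi => ?_, fun j => ?_⟩)
    · have hker : LinearMap.ker g ≤ span 𝕜 (Set.range (fun i => if i ∈ Z then p i else 0) ∪
          Set.range fun j => (b j : M.X t₁)) := by
        refine le_trans ?_ (span_mono Set.subset_union_right)
        have h1 := b.span_eq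
        have h2 := congrArg (Submodule.map (LinearMap.ker g).subtype) h1
        rw [Submodule.map_span, map_subtype_top, ← Set.range_comp] at h2
        exact h2.ge
      rw [eq_top_iff]
      intro x _
      -- The lifts span modulo the kernel of `g`, which is itself spanned by the `b j`.
      have hx : g x ∈ (span 𝕜 (Set.range (fun i => if i ∈ Z then p i else 0) ∪
          Set.range fun j => (b j : M.X t₁))).map g := by
        have h1 : g x ∈ span 𝕜 ((fun i => e i t₀) '' Z) := hs.ge ⟨x, rfl⟩
        rw [Submodule.map_span]
        refine span_mono ?_ h1
        rintro _ ⟨i, hi, rfl⟩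
        exact ⟨p i, Or.inl ⟨i, if_pos hi⟩, hp i hi⟩
      obtain ⟨y, hy, hyx⟩ := hx
      have h1 : x - y ∈ LinearMap.ker g := by rw [LinearMap.mem_ker, map_sub, hyx, sub_self]
      have h2 := add_mem (hker h1) hy
      rwa [sub_add_cancel] at h2
    · rw [hc, Nat.card_fin, LinearMap.finrank_range_add_finrank_ker]
    · simp only [hi, if_true]
      exact hp i hi
    · exact (b j).2
  · have a : Arrow t₀.1 t₁.1 := ⟨hodd, Or.inr ht⟩
    have na : ¬ Arrow t₁.1 t₀.1 := fun a => by
      have := a.1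
      rw [ht] at this
      exact (Nat.not_odd_iff_even.2 hodd.add_one) this
    set f := M.map t₀ t₁ a
    obtain ⟨e, Z, h, hZA, hZ, hind⟩ := h.exists_adapted f
    let U := span 𝕜 (Set.range fun i : ({i | (bar i).last = t₀.1} \ Z : Set ι) => f (e i t₀))
    obtain ⟨C, hUC⟩ := Submodule.exists_isCompl U
    let b := Module.finBasis 𝕜 C
    refine h.extend ht ({i | (bar i).last = t₀.1} \ Z) (fun i hi => hi.1)
      (fun i => if i ∈ {i | (bar i).last = t₀.1} \ Z then f (e i t₀) else 0)
      (fun i hi => if_neg hi)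
      (fun j => (b j : M.X t₁)) ?_ ?_ (fun _ i hi => ?_) (fun a => absurd a na)
    · rw [span_union, eq_top_iff, ← hUC.sup_eq_top]
      apply sup_le_sup
      · apply span_mono
        rintro _ ⟨i, rfl⟩
        exact ⟨i, if_pos i.2⟩
      · have h1 := b.span_eq
        have h2 := congrArg (Submodule.map C.subtype) h1
        rw [Submodule.map_span, map_subtype_top, ← Set.range_comp] at h2
        exact h2.ge
    · rw [Nat.card_fin, ← finrank_add_eq_of_isCompl hUC, finrank_span_eq_card hind,
        Nat.card_eq_fintype_card]
    · by_cases hiZ : i ∈ Z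
      · rw [if_neg (fun h' => h'.2 hiZ)]
        exact hZ i hiZ
      · exact (if_pos ⟨hi, hiZ⟩).symm

theorem IsIntervalBasis.exists_of_le (M : ZigzagModule.{v, w} 𝕜 m n)
    [∀ t, FiniteDimensional 𝕜 (M.X t)] (r : ℕ) (hmr : m ≤ r) (hrn : r ≤ n) :
    ∃ (ι : Type) (_ : Fintype ι) (bar : ι → Bar) (e : ι → ∀ t, M.X t),
      IsIntervalBasis M r bar e := by
  classical
  induction r, hmr using Nat.le_induction with
  | base =>
    let t₀ : Set.Icc m n := ⟨m, le_rfl, hrn⟩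
    let b := Module.finBasis 𝕜 (M.X t₀)
    have ht₀ : ∀ t : Set.Icc m n, t.1 ≤ m → t = t₀ := fun t h =>
      Subtype.ext (le_antisymm h t.2.1)
    refine ⟨_, inferInstance, fun _ => ⟨m, m, le_rfl⟩, fun i => Function.update 0 t₀ (b i),
      ⟨fun _ => le_rfl, fun _ => le_rfl, fun i t ht => ?_, fun s t a hs ht => ?_, fun t ht => ?_,
        fun t ht => ?_⟩⟩
    · apply Function.update_of_ne
      rintro rfl
      exact ht ⟨le_rfl, le_rfl⟩
    · have := a.2
      have := s.2.1
      have := t.2.1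
      omega
    · obtain rfl := ht₀ t ht
      simp only [Function.update_self]
      exact b.span_eq
    · obtain rfl := ht₀ t ht
      simp [t₀]
  | succ r hmr ih =>
    obtain ⟨ι, _, bar, e, h⟩ := ih (by omega)
    exact h.exists_succ (t₀ := ⟨r, hmr, by omega⟩) (t₁ := ⟨r + 1, by omega, hrn⟩) rfl

open Classical in
/-- The coefficients of a vector in a sum of interval modules, extended by zero to all bars. -/
noncomputable def coeff {B : Multiset Bar} {t : Set.Icc m n} (f : (intervalSum 𝕜 m n B).X t)
    (x : B.ToType) : 𝕜 :=
  if h : t.1 ∈ Set.Icc x.1.first x.1.last then f ⟨x, h⟩ else 0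

open Classical in
theorem coeff_apply {B : Multiset Bar} {t : Set.Icc m n} (f : (intervalSum 𝕜 m n B).X t)
    {x : B.ToType} (h : t.1 ∈ Set.Icc x.1.first x.1.last) : coeff f x = f ⟨x, h⟩ :=
  dif_pos h

open Classical in
theorem coeff_of_notMem {B : Multiset Bar} {t : Set.Icc m n} (f : (intervalSum 𝕜 m n B).X t)
    {x : B.ToType} (h : t.1 ∉ Set.Icc x.1.first x.1.last) : coeff f x = 0 :=
  dif_neg h

-- The bar need not contain `s`: if it does not, both sides are zero.
open Classical in
theorem coeff_map {B : Multiset Bar} {s t : Set.Icc m n} (a : Arrow s.1 t.1)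
    (f : (intervalSum 𝕜 m n B).X s) {x : B.ToType} (h : t.1 ∈ Set.Icc x.1.first x.1.last) :
    coeff ((intervalSum 𝕜 m n B).map s t a f) x = coeff f x :=
  dif_pos h

/-- Every pointwise finite-dimensional zigzag module has a barcode. -/
theorem ZigzagModule.exists_isBarcode (M : ZigzagModule.{v, w} 𝕜 m n)
    [∀ t, FiniteDimensional 𝕜 (M.X t)] (hmn : m ≤ n) : ∃ B, IsBarcode M B := by
  classical
  obtain ⟨ι, _, bar, e, h⟩ := IsIntervalBasis.exists_of_le M n hmn le_rfl
  let B : Multiset Bar := (Finset.univ : Finset ι).val.map bar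
  have hcount : ∀ i, (Finset.univ : Finset ι).val.count i = 1 := Multiset.count_univ
  -- Every element of `univ` has multiplicity one, so its only copy carries the index `0`.
  let E₀ : ι ≃ (Finset.univ : Finset ι).val.ToType :=
    { toFun := fun i => ⟨i, ⟨0, by rw [hcount]; exact one_pos⟩⟩
      invFun := fun x => x.1
      left_inv := fun i => rfl
      right_inv := by
        rintro ⟨i, k, hk⟩
        have := hcount i
        exact Sigma.ext rfl (heq_of_eq (Fin.ext (by simp only; omega))) }
  let E : ι ≃ B.ToType := E₀.trans (Multiset.mapEquiv _ bar)
  have hE : ∀ i, (E i).1 = bar i := fun i => Multiset.mapEquiv_apply _ _ _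
  have hE' : ∀ x : B.ToType, bar (E.symm x) = x.1 := fun x => by
    rw [← hE, E.apply_symm_apply]
  refine ⟨B, fun I hI => ?_, ?_⟩
  · obtain ⟨i, -, rfl⟩ := Multiset.mem_map.1 hI
    exact ⟨h.le_first i, h.last_le i⟩
  have hzero : ∀ (x : B.ToType) t, t.1 ∉ Set.Icc x.1.first x.1.last → e (E.symm x) t = 0 :=
    fun x t hx => h.eq_zero _ t (by rwa [hE'])
  let v : ∀ t : Set.Icc m n, {x : B.ToType // t.1 ∈ Set.Icc x.1.first x.1.last} → M.X t :=
    fun t x => e (E.symm x.1) t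
  have hspan : ∀ t, ⊤ ≤ span 𝕜 (Set.range (v t)) := by
    intro t
    rw [← h.span_eq t t.2.2, span_le]
    rintro _ ⟨i, rfl⟩
    by_cases hi : t.1 ∈ Set.Icc (E i).1.first (E i).1.last
    · exact subset_span ⟨⟨E i, hi⟩, by simp [v]⟩
    · have := hzero (E i) t hi
      rw [E.symm_apply_apply] at this
      simp only [this]
      exact zero_mem _
  have hind : ∀ t, LinearIndependent 𝕜 (v t) := by
    intro t
    apply linearIndependent_of_top_le_span_of_card_eq_finrank (hspan t)
    rw [← h.card_eq t t.2.2, ← Nat.card_eq_fintype_card]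
    exact Nat.card_congr (E.symm.subtypeEquiv fun x => by simp [hE'])
  let b : ∀ t : Set.Icc m n,
      Module.Basis {x : B.ToType // t.1 ∈ Set.Icc x.1.first x.1.last} 𝕜 (M.X t) :=
    fun t => Module.Basis.mk (hind t) (hspan t)
  let ε : ∀ t, M.X t ≃ₗ[𝕜] (intervalSum 𝕜 m n B).X t := fun t => (b t).equivFun
  -- Summing over all bars, with zero coefficients off `t`, gives sums at different positions the
  -- same index type.
  have hsum : ∀ t (f : (intervalSum 𝕜 m n B).X t),
      (ε t).symm f = ∑ x, coeff f x • e (E.symm x) t := by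
    intro t f
    have h1 := Finset.sum_subtype (F := inferInstance) (p := fun x : B.ToType => t.1 ∈ Set.Icc x.1.first x.1.last)
      (Finset.univ.filter fun x : B.ToType => t.1 ∈ Set.Icc x.1.first x.1.last)
      (by simp) (fun x => coeff f x • e (E.symm x) t)
    rw [Finset.sum_filter] at h1
    refine ((b t).equivFun_symm_apply f).trans (Eq.trans ?_ (h1.symm.trans (Finset.sum_congr rfl fun x _ => ?_)))
    · refine Finset.sum_congr rfl fun x _ => ?_
      rw [coeff_apply f x.2, Module.Basis.mk_apply]
    · split_ifs with hx
      · rfl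
      · rw [coeff_of_notMem f hx, zero_smul]
  refine ⟨ε, fun s t a x => ?_⟩
  -- Compatibility with the arrows is checked for the inverse maps, where it can be compared bar by
  -- bar.
  obtain ⟨f, rfl⟩ := (ε s).symm.surjective x
  rw [LinearEquiv.apply_symm_apply, ← LinearEquiv.eq_symm_apply, hsum, hsum]
  rw [map_sum]
  refine Finset.sum_congr rfl fun x _ => ?_
  rw [map_smul]
  by_cases hs : s.1 ∈ Set.Icc x.1.first x.1.last
  · rw [h.map_eq s t a s.2.2 t.2.2 _ (by rwa [hE'])]
    by_cases ht : t.1 ∈ Set.Icc x.1.first x.1.last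
    · rw [coeff_map a f ht]
    · rw [hzero x t ht, smul_zero, smul_zero]
  · rw [coeff_of_notMem f hs, zero_smul]
    by_cases ht : t.1 ∈ Set.Icc x.1.first x.1.last
    · rw [coeff_map a f ht, coeff_of_notMem f hs, zero_smul]
    · rw [coeff_of_notMem _ ht, zero_smul]

end Decomposition

/-! ### Restriction to a bar and comparison of barcodes. -/

section Restriction

universe w' w''

variable {𝕜 : Type v} [Field 𝕜] {m n m' n' p q : ℕ}

theorem ZigzagModule.Isomorphic.symm {M : ZigzagModule.{v, w} 𝕜 m n}
    {M' : ZigzagModule.{v, w'} 𝕜 m n} (h : M.Isomorphic M') : M'.Isomorphic M := by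
  obtain ⟨e, he⟩ := h
  refine ⟨fun t => (e t).symm, fun s t a x => ?_⟩
  rw [LinearEquiv.symm_apply_eq, he, LinearEquiv.apply_symm_apply]

theorem ZigzagModule.Isomorphic.trans {M : ZigzagModule.{v, w} 𝕜 m n}
    {M' : ZigzagModule.{v, w'} 𝕜 m n} {M'' : ZigzagModule.{v, w''} 𝕜 m n}
    (h : M.Isomorphic M') (h' : M'.Isomorphic M'') : M.Isomorphic M'' := by
  obtain ⟨e, he⟩ := h
  obtain ⟨e', he'⟩ := h'
  refine ⟨fun t => (e t).trans (e' t), fun s t a x => ?_⟩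
  rw [LinearEquiv.trans_apply, he, he', LinearEquiv.trans_apply]

/-- The restriction of a zigzag module to the positions `p, …, q`. -/
def ZigzagModule.restrict (M : ZigzagModule.{v, w} 𝕜 m n) (hp : m ≤ p) (hq : q ≤ n) :
    ZigzagModule.{v, w} 𝕜 p q where
  X t := M.X ⟨t.1, hp.trans t.2.1, t.2.2.trans hq⟩
  map s t a := M.map ⟨s.1, hp.trans s.2.1, s.2.2.trans hq⟩ ⟨t.1, hp.trans t.2.1, t.2.2.trans hq⟩ a

theorem ZigzagModule.Isomorphic.restrict {M : ZigzagModule.{v, w} 𝕜 m n}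
    {M' : ZigzagModule.{v, w'} 𝕜 m n} (h : M.Isomorphic M') (hp : m ≤ p) (hq : q ≤ n) :
    (M.restrict hp hq).Isomorphic (M'.restrict hp hq) := by
  obtain ⟨e, he⟩ := h
  exact ⟨fun t => e ⟨t.1, hp.trans t.2.1, t.2.2.trans hq⟩, fun s t a x => he _ _ a x⟩

open Classical in
/-- The generator of the summand of the bar `x` at the position `t`. -/
noncomputable def generator {B : Multiset Bar} (x : B.ToType) (t : Set.Icc m n) :
    (intervalSum 𝕜 m n B).X t :=
  fun y => if y.1 = x then 1 else 0

open Classical in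
theorem map_generator {B : Multiset Bar} (x : B.ToType) {s t : Set.Icc m n}
    (a : Arrow s.1 t.1) (hs : s.1 ∈ Set.Icc x.1.first x.1.last) :
    (intervalSum 𝕜 m n B).map s t a (generator x s) = generator x t := by
  funext y
  change (if h : _ then _ else _) = ite _ _ _
  by_cases hy : y.1 = x
  · rw [if_pos hy, dif_pos (by rw [hy]; exact hs)]
    exact if_pos hy
  · rw [if_neg hy]
    split_ifs
    · exact if_neg hy
    · rfl

open Classical in
theorem coeff_generator_self {B : Multiset Bar} (x : B.ToType) {t : Set.Icc m n}
    (h : t.1 ∈ Set.Icc x.1.first x.1.last) :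
    coeff (generator x t : (intervalSum 𝕜 m n B).X t) x = 1 := by
  rw [coeff_apply _ h]
  exact if_pos rfl

open Classical in
theorem generator_of_notMem {B : Multiset Bar} (x : B.ToType) {t : Set.Icc m n}
    (h : t.1 ∉ Set.Icc x.1.first x.1.last) :
    (generator x t : (intervalSum 𝕜 m n B).X t) = 0 := by
  funext y
  exact if_neg fun hy => h (by rw [← hy]; exact y.2)

open Classical in
/-- A coefficient as a linear functional. -/
noncomputable def coeffHom {B : Multiset Bar} (t : Set.Icc m n) (x : B.ToType) :
    (intervalSum 𝕜 m n B).X t →ₗ[𝕜] 𝕜 where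
  toFun f := coeff f x
  map_add' f g := by
    by_cases h : t.1 ∈ Set.Icc x.1.first x.1.last
    · simp only [coeff_apply _ h]
      rfl
    · simp only [coeff_of_notMem _ h, add_zero]
  map_smul' c f := by
    by_cases h : t.1 ∈ Set.Icc x.1.first x.1.last
    · simp only [coeff_apply _ h]
      rfl
    · simp only [coeff_of_notMem _ h, smul_zero]

open Classical in
theorem sum_coeff_smul_generator {B : Multiset Bar} {t : Set.Icc m n}
    (f : (intervalSum 𝕜 m n B).X t) : ∑ x : B.ToType, coeff f x • generator x t = f := by
  funext y
  have h : ∀ x : B.ToType, (coeff f x • generator x t : (intervalSum 𝕜 m n B).X t) y =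
      if y.1 = x then f y else 0 := by
    intro x
    change coeff f x * (if y.1 = x then 1 else 0) = _
    split_ifs with hx
    · subst hx
      rw [coeff_apply f y.2, mul_one]
    · rw [mul_zero]
  refine (Finset.sum_apply y _ _).trans ?_
  simp only [h, Finset.sum_ite_eq, Finset.mem_univ, if_true]

/-- If two zigzag modules agree along a bar of the first, then that bar is contained in a bar of the
second. -/
theorem exists_bar_of_isomorphic_restrict {M : ZigzagModule.{v, w} 𝕜 m n}
    {M' : ZigzagModule.{v, w'} 𝕜 m' n'} {B C : Multiset Bar} (hB : IsBarcode M B)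
    (hC : IsBarcode M' C) {I : Bar} (hI : I ∈ B) (hm : m ≤ I.first) (hn : I.last ≤ n)
    (hm' : m' ≤ I.first) (hn' : I.last ≤ n')
    (h : (M.restrict hm hn).Isomorphic (M'.restrict hm' hn')) :
    ∃ J ∈ C, J.first ≤ I.first ∧ I.last ≤ J.last := by
  classical
  obtain ⟨e₀, he₀⟩ := ((hB.2.restrict hm hn).symm.trans h).trans (hC.2.restrict hm' hn')
  let x₀ : B.ToType := ⟨I, ⟨0, Multiset.count_pos.2 hI⟩⟩
  let α : ∀ t : Set.Icc I.first I.last, Set.Icc m n :=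
    fun t => ⟨t.1, hm.trans t.2.1, t.2.2.trans hn⟩
  let β : ∀ t : Set.Icc I.first I.last, Set.Icc m' n' :=
    fun t => ⟨t.1, hm'.trans t.2.1, t.2.2.trans hn'⟩
  let e : ∀ t, (intervalSum 𝕜 m n B).X (α t) ≃ₗ[𝕜] (intervalSum 𝕜 m' n' C).X (β t) := e₀
  have he : ∀ s t (a : Arrow s.1 t.1) x, e t ((intervalSum 𝕜 m n B).map (α s) (α t) a x) =
      (intervalSum 𝕜 m' n' C).map (β s) (β t) a (e s x) := he₀
  have he' : ∀ s t (a : Arrow s.1 t.1) y,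
      (e t).symm ((intervalSum 𝕜 m' n' C).map (β s) (β t) a y) =
      (intervalSum 𝕜 m n B).map (α s) (α t) a ((e s).symm y) := by
    intro s t a y
    rw [LinearEquiv.symm_apply_eq, he, LinearEquiv.apply_symm_apply]
  clear_value e
  -- The scalar by which `x₀ → y → x₀` acts at `t`.
  let c : Set.Icc I.first I.last → C.ToType → 𝕜 := fun t y =>
    coeff (e t (generator x₀ (α t))) y * coeff ((e t).symm (generator y (β t))) x₀
  have hc_zero : ∀ t y, t.1 ∉ Set.Icc y.1.first y.1.last → c t y = 0 := by
    intro t y hy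
    change coeff (e t (generator x₀ (α t))) y * _ = 0
    rw [coeff_of_notMem (t := β t) _ hy, zero_mul]
  -- If `y` contains both ends, both factors are preserved. If it contains only `s`, the arrow kills
  -- the generator of `y`, so the second factor vanishes at `s`. If it contains only `t`, the first
  -- factor at `t` is a coefficient at `s`, where `y` is absent.
  have hc_arrow : ∀ s t, Arrow s.1 t.1 → ∀ y, c s y = c t y := by
    intro s t a y
    have h1 : coeff (e t (generator x₀ (α t))) y = coeff
        ((intervalSum 𝕜 m' n' C).map (β s) (β t) a (e s (generator x₀ (α s)))) y := by
      rw [← he, map_generator x₀ (s := α s) (t := α t) a s.2]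
    have h2 : coeff ((e s).symm (generator y (β s))) x₀ = coeff
        ((e t).symm ((intervalSum 𝕜 m' n' C).map (β s) (β t) a (generator y (β s)))) x₀ := by
      rw [he', coeff_map (s := α s) (t := α t) (x := x₀) a _ t.2]
    by_cases hs : s.1 ∈ Set.Icc y.1.first y.1.last
    · rw [map_generator (s := β s) (t := β t) y a hs] at h2
      by_cases ht : t.1 ∈ Set.Icc y.1.first y.1.last
      · rw [coeff_map (s := β s) (t := β t) a _ ht] at h1
        simp only [c, h1, h2]
      · have h3 : coeff (0 : (intervalSum 𝕜 m n B).X (α t)) x₀ = 0 := map_zero (coeffHom (α t) x₀)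
        rw [generator_of_notMem (t := β t) y ht, map_zero, h3] at h2
        rw [hc_zero t y ht]
        simp only [c, h2, mul_zero]
    · rw [hc_zero s y hs]
      by_cases ht : t.1 ∈ Set.Icc y.1.first y.1.last
      · rw [coeff_map (s := β s) (t := β t) a _ ht, coeff_of_notMem (t := β s) _ hs] at h1
        simp only [c, h1, zero_mul]
      · rw [hc_zero t y ht]
  -- This is the `x₀`-coefficient of the inverse of `e t` composed with `e t`, applied to the
  -- generator of `x₀`.
  have hc_sum : ∀ t, ∑ y, c t y = 1 := by
    intro t
    have h1 := congrArg ((coeffHom (α t) x₀).comp (e t).symm.toLinearMap)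
      (sum_coeff_smul_generator (e t (generator x₀ (α t))))
    have h2 : ((coeffHom (α t) x₀).comp (e t).symm.toLinearMap) (e t (generator x₀ (α t))) = 1 := by
      refine Eq.trans ?_ (coeff_generator_self (𝕜 := 𝕜) x₀ (t := α t) t.2)
      exact congrArg (coeffHom (α t) x₀) ((e t).symm_apply_apply _)
    rw [← h2, ← h1, map_sum]
    refine Finset.sum_congr rfl fun y _ => ?_
    exact (map_smul ((coeffHom (α t) x₀).comp (e t).symm.toLinearMap) _ _).symm
  have hc_const : ∀ k (hk : I.first + k ≤ I.last) y,
      c ⟨I.first + k, Nat.le_add_right _ _, hk⟩ y = c ⟨I.first, le_rfl, I.le⟩ y := by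
    intro k
    induction k with
    | zero => exact fun _ _ => rfl
    | succ k ih =>
      intro hk y
      rw [← ih (by omega)]
      rcases Nat.even_or_odd (I.first + k) with h1 | h1
      · exact hc_arrow _ _ ⟨h1.add_one, Or.inl rfl⟩ y
      · exact (hc_arrow _ _ ⟨h1, Or.inr rfl⟩ y).symm
  obtain ⟨y, -, hy⟩ := Finset.exists_ne_zero_of_sum_ne_zero
    ((hc_sum ⟨I.first, le_rfl, I.le⟩).trans_ne one_ne_zero)
  refine ⟨y.1, Multiset.coe_mem, ?_, ?_⟩
  · by_contra hlt
    exact hy (hc_zero _ y fun hmem => hlt hmem.1)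
  · by_contra hlt
    have hle := I.le
    have h1 := hc_const (I.last - I.first) (by omega) y
    refine hy (h1 ▸ hc_zero _ y fun hmem => hlt ?_)
    have := hmem.2
    simp only at this
    omega

end Restriction

/-! ### Barcodes of filtrations that share a subfiltration. -/

section Redundancy

variable {𝕜 : Type v} [Field 𝕜] {V : Type u} {K : PreAbstractSimplicialComplex V}

theorem Bar.carrier_mono {I J : Bar} (h₁ : J.first ≤ I.first) (h₂ : I.last ≤ J.last) :
    I.carrier ⊆ J.carrier :=
  Set.biUnion_subset_biUnion_left (Set.Icc_subset_Icc h₁ h₂)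

theorem SameSubfiltration.term_eq {F G : ZigzagFiltration K} {a b : ℕ}
    (h : SameSubfiltration F G a b) {t : ℕ} (hF : t ∈ Set.Icc (2 * F.lo) (2 * F.hi))
    (hG : t ∈ Set.Icc (2 * G.lo) (2 * G.hi)) (hat : 2 * a ≤ t) (htb : t ≤ 2 * b) :
    F.term ⟨t, hF⟩ = G.term ⟨t, hG⟩ := by
  obtain ⟨hab, hF₁, hF₂, hG₁, hG₂, heq⟩ := h
  -- The terms of a subfiltration are definitionally those of the filtration. Generalizing both
  -- sides allows the equality to be substituted despite the dependent index types.
  have key : ∀ {F' G' : ZigzagFiltration K} (_ : G' = F')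
      (h₁ : t ∈ Set.Icc (2 * F'.lo) (2 * F'.hi)) (h₂ : t ∈ Set.Icc (2 * G'.lo) (2 * G'.hi)),
      F'.term ⟨t, h₁⟩ = G'.term ⟨t, h₂⟩ := by
    rintro F' _ rfl _ _
    rfl
  exact key heq ⟨hat, htb⟩ ⟨hat, htb⟩

variable [LinearOrder V]

theorem finiteDimensional_relHomology (hK : K.faces.Finite) (k : ℕ) (P E : Set (Simplex K)) :
    FiniteDimensional 𝕜 (RelHomology 𝕜 k P E) := by
  have : Finite (Simplex K) := hK
  have : FiniteDimensional 𝕜 (Chains 𝕜 K) :=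
    inferInstanceAs (FiniteDimensional 𝕜 (Simplex K →₀ 𝕜))
  infer_instance

theorem ZigzagFiltration.exists_isBarcodeOf (hK : K.faces.Finite) (k : ℕ)
    (F : ZigzagFiltration K) : ∃ B, IsBarcodeOf 𝕜 k F B := by
  have : ∀ t, FiniteDimensional 𝕜 ((F.homology 𝕜 k).X t) :=
    fun t => finiteDimensional_relHomology hK k _ _
  exact (F.homology 𝕜 k).exists_isBarcode (Nat.mul_le_mul_left 2 F.le)

theorem relHomologyMap_comp {k : ℕ} {P E P' E' P'' E'' : Set (Simplex K)}
    (hP : P ⊆ P') (hE : E ⊆ E') (hP' : P' ⊆ P'') (hE' : E' ⊆ E'') (x : RelHomology 𝕜 k P E) :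
    relHomologyMap 𝕜 k hP' hE' (relHomologyMap 𝕜 k hP hE x) =
      relHomologyMap 𝕜 k (hP.trans hP') (hE.trans hE') x := by
  obtain ⟨z, rfl⟩ := Submodule.Quotient.mk_surjective _ x
  rfl

theorem relHomologyMap_refl {k : ℕ} {P E : Set (Simplex K)} (x : RelHomology 𝕜 k P E) :
    relHomologyMap 𝕜 k subset_rfl subset_rfl x = x := by
  obtain ⟨z, rfl⟩ := Submodule.Quotient.mk_surjective _ x
  rfl

/-- The identity of the homology of equal pairs. -/
noncomputable def relHomologyCongr {k : ℕ} {A A' : ClosedPair K} (h : A = A') :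
    RelHomology 𝕜 k A.P A.E ≃ₗ[𝕜] RelHomology 𝕜 k A'.P A'.E :=
  have hP : A.P ⊆ A'.P := h ▸ subset_rfl
  have hE : A.E ⊆ A'.E := h ▸ subset_rfl
  have hP' : A'.P ⊆ A.P := h ▸ subset_rfl
  have hE' : A'.E ⊆ A.E := h ▸ subset_rfl
  LinearEquiv.ofLinearMap (relHomologyMap 𝕜 k hP hE) (relHomologyMap 𝕜 k hP' hE')
    (LinearMap.ext fun x => (relHomologyMap_comp hP' hE' hP hE x).trans (relHomologyMap_refl x))
    (LinearMap.ext fun x => (relHomologyMap_comp hP hE hP' hE' x).trans (relHomologyMap_refl x))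

/-- `relHomologyCongr` is induced by inclusions rather than by a cast, so both sides send the class
of a cycle to the class of the same chain. -/
theorem relHomologyCongr_map {k : ℕ} {A A' B B' : ClosedPair K} (h : A = A') (h' : B = B')
    (hP : A.P ⊆ B.P) (hE : A.E ⊆ B.E) (hP' : A'.P ⊆ B'.P) (hE' : A'.E ⊆ B'.E)
    (x : RelHomology 𝕜 k A.P A.E) :
    relHomologyCongr h' (relHomologyMap 𝕜 k hP hE x) =
      relHomologyMap 𝕜 k hP' hE' (relHomologyCongr h x) := by
  obtain ⟨z, rfl⟩ := Submodule.Quotient.mk_surjective _ x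
  rfl

theorem SameSubfiltration.exists_bar {F G : ZigzagFiltration K} {k : ℕ} {I : Bar}
    (h : SameSubfiltration F G I.left I.right) {B C : Multiset Bar} (hB : IsBarcodeOf 𝕜 k F B)
    (hC : IsBarcodeOf 𝕜 k G C) (hI : I ∈ B) : ∃ J ∈ C, I.carrier ⊆ J.carrier := by
  -- `left` rounds down and `right` rounds up, so every position of `I` lies in the shared range,
  -- also when an end of `I` is open.
  have hl : 2 * I.left ≤ I.first := by unfold Bar.left; omega
  have hr : I.last ≤ 2 * I.right := by unfold Bar.right; omega
  obtain ⟨hm, hn⟩ := hB.1 I hI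
  have hm' : 2 * G.lo ≤ I.first := by
    obtain ⟨_, _, _, h1, _⟩ := h
    omega
  have hn' : I.last ≤ 2 * G.hi := by
    obtain ⟨_, _, _, _, h1, _⟩ := h
    omega
  obtain ⟨J, hJ, h1, h2⟩ := exists_bar_of_isomorphic_restrict hB hC hI hm hn hm' hn'
    ⟨fun t => relHomologyCongr (h.term_eq ⟨hm.trans t.2.1, t.2.2.trans hn⟩
      ⟨hm'.trans t.2.1, t.2.2.trans hn'⟩ (hl.trans t.2.1) (t.2.2.trans hr)),
    fun s t a x => relHomologyCongr_map _ _ (F.term_mono _ _ a).1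
      (F.term_mono _ _ a).2 (G.term_mono _ _ a).1 (G.term_mono _ _ a).2 x⟩
  exact ⟨J, hJ, Bar.carrier_mono h1 h2⟩

end Redundancy

end ConleyMorse

theorem mainTheorem6 {𝕜 : Type v} [Field 𝕜] {V : Type u} [LinearOrder V]
    (K : PreAbstractSimplicialComplex V) (hK : K.faces.Finite)
    (N : Set (ConleyMorse.Simplex K)) (n : ℕ)
    (D : Fin n → ConleyMorse.ConleyMorseDatum.{u, v, w} 𝕜 N) (k : ℕ)
    (F : ConleyMorse.ZigzagFiltration K) (hF : F ∈ ConleyMorse.conleyMorseFiltrations D)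
    (B : Multiset ConleyMorse.Bar) (hB : ConleyMorse.IsBarcodeOf 𝕜 k F B)
    (I : ConleyMorse.Bar) (hI : I ∈ B) (hred : ConleyMorse.IsRedundant D F I) :
    (∃ G, ConleyMorse.IsRedundancyWitness D F I G ∧
      ∃ C, ConleyMorse.IsBarcodeOf 𝕜 k G C ∧ ∃ J ∈ C, I.carrier ⊆ J.carrier) ∧
    ∀ G, ConleyMorse.IsRedundancyWitness D F I G →
      (∃ C, ConleyMorse.IsBarcodeOf 𝕜 k G C) ∧
      ∀ C, ConleyMorse.IsBarcodeOf 𝕜 k G C → ∃ J ∈ C, I.carrier ⊆ J.carrier := by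
  have key : ∀ G, ConleyMorse.IsRedundancyWitness D F I G →
      (∃ C, ConleyMorse.IsBarcodeOf 𝕜 k G C) ∧
      ∀ C, ConleyMorse.IsBarcodeOf 𝕜 k G C → ∃ J ∈ C, I.carrier ⊆ J.carrier :=
    fun G hG => ⟨G.exists_isBarcodeOf hK k, fun C hC => hG.2.2.exists_bar hB hC hI⟩
  obtain ⟨G, hG⟩ := hred
  obtain ⟨C, hC⟩ := (key G hG).1
  exact ⟨⟨G, hG, C, hC, (key G hG).2 C hC⟩, key⟩
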